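/- Let $G=(V,E)$ be a finite simple graph. For $P=(x,y)\in\mathbb{C}^2$ put $d(P)=x^2+y^2$. A complex (real) realisation of $G$ is a map $p$ from $V$ to $\mathbb{C}^2$ ($\mathbb{R}^2$); it is generic if its $2|V|$ coordinates are algebraically independent over $\mathbb{Q}$. Two realisations $p,q$ of $G$ are equivalent if $d(p(u)-p(v))=d(q(u)-q(v))$ for all $uv\in E$, and congruent if this holds for all $u,v\in V$. A real realisation $p$ is rigid if there is $\varepsilon>0$ such that every real realisation $q$ equivalent to $p$ with $d(p(v)-q(v))<\varepsilon$ for all $v\in V$ is congruent to $p$; the graph $G$ is rigid if some generic real realisation of $G$ is rigid. For a complex realisation $p$ of $G$, let $c(G,p)$ be the number of congruence classes in the set of all complex realisations of $G$ equivalent to $p$. If $c(G,p)$ is finite and takes the same value for all generic complex realisations $p$ of $G$, this common value is denoted $c(G)$. Let $G=(V,E)$ be a rigid graph with at least four vertices, let $v_n\in V$ have exactly two neighbours, $N(v_n)=\{v_1,v_2\}$ with $v_1\neq v_2$, and let $H=G-v_n$. Then $H$ is rigid, $c(G)$ and $c(H)$ are well defined (i.e. $c(G,p)$, respectively $c(H,p)$,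 is finite and the same for all generic complex realisations $p$), and $$c(G)=2\,c(H).$$ In other words, a Henneberg type 1 move, which adds to a graph $H$ with at least three vertices a new vertex joined to two distinct vertices of $H$ and produces a rigid graph $G$, doubles $c$. -/

import Mathlib

/-- The squared length `d(x, y) = x ^ 2 + y ^ 2` of a point of the plane `K ^ 2`. -/
def sqLen {K : Type*} [CommRing K] (P : Fin 2 → K) : K := P 0 ^ 2 + P 1 ^ 2

/-- A realisation `p : V → K ^ 2` is generic if its `2 |V|` coordinates are algebraically
independent over `ℚ`. -/
def IsGeneric {V K : Type*} [CommRing K] [Algebra ℚ K] (p : V → Fin 2 → K) : Prop :=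
  AlgebraicIndependent ℚ (fun x : V × Fin 2 => p x.1 x.2)

/-- `(G, p)` and `(G, q)` are equivalent: they have the same squared edge lengths. -/
def FrameworkEquivalent {V K : Type*} [CommRing K] (G : SimpleGraph V)
    (p q : V → Fin 2 → K) : Prop :=
  ∀ u v : V, G.Adj u v → sqLen (p u - p v) = sqLen (q u - q v)

/-- `p` and `q` are congruent: all pairs of vertices have the same squared distance. -/
def FrameworkCongruent {V K : Type*} [CommRing K] (p q : V → Fin 2 → K) : Prop :=
  ∀ u v : V, sqLen (p u - p v) = sqLen (q u - q v)

/-- A real framework `(G, p)` is rigid if every equivalent real framework sufficiently close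
to it is congruent to it. -/
def IsRigidFramework {V : Type*} (G : SimpleGraph V) (p : V → Fin 2 → ℝ) : Prop :=
  ∃ ε : ℝ, 0 < ε ∧ ∀ q : V → Fin 2 → ℝ, FrameworkEquivalent G p q →
    (∀ v, sqLen (p v - q v) < ε) → FrameworkCongruent p q

/-- A graph is rigid if some generic real realisation of it is rigid. -/
def IsRigidGraph {V : Type*} (G : SimpleGraph V) : Prop :=
  ∃ p : V → Fin 2 → ℝ, IsGeneric p ∧ IsRigidFramework G p

/-- Congruence, as an equivalence relation on the set of all complex realisations of `G` which
are equivalent to `(G, p)`. -/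
def congruenceSetoid {V : Type*} (G : SimpleGraph V) (p : V → Fin 2 → ℂ) :
    Setoid {q : V → Fin 2 → ℂ // FrameworkEquivalent G p q} where
  r q q' := FrameworkCongruent q.1 q'.1
  iseqv :=
    { refl := fun _ _ _ => rfl
      symm := fun h u v => (h u v).symm
      trans := fun h h' u v => (h u v).trans (h' u v) }

/-- The congruence classes of complex realisations of `G` equivalent to `(G, p)`. -/
def CongruenceClasses {V : Type*} (G : SimpleGraph V) (p : V → Fin 2 → ℂ) : Type _ :=
  Quotient (congruenceSetoid G p)

/-- `k` is the common value of the (finite) number `c(G, p)` of congruence classes, over all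
generic complex realisations `(G, p)`. -/
def IsRealisationNumber {V : Type*} (G : SimpleGraph V) (k : ℕ) : Prop :=
  ∀ p : V → Fin 2 → ℂ, IsGeneric p →
    Finite (CongruenceClasses G p) ∧ Nat.card (CongruenceClasses G p) = k

open Classical in
/-- The number `c(G)`: the common value of `c(G, p)` over all generic complex realisations
(and `0` if there is no finite common value). -/
noncomputable def realisationNumber {V : Type*} (G : SimpleGraph V) : ℕ :=
  if h : ∃ k, IsRealisationNumber G k then h.choose else 0

open Filter Topology

/-! Rigidity at one generic real realisation is turned into algebra
(`IsRigidFramework.isAlgebraicallyRigid`): in indeterminate coordinates, every squared distance is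
algebraic over the squared edge lengths. By `IsGeneric.finite_values`, every complex realisation
equivalent to a generic one then has distances in fixed finite sets, and no distance or area between
distinct vertices vanishes. So the classes are finite in number; the number is constant because
automorphisms of ℂ permute generic realisations transitively.

`H` inherits rigidity since `vn` can follow a small motion of `H` continuously. Restriction sends
classes of `G` to classes of `H`, and every fibre has two elements: `vn` lies on circles about `v₁`
and `v₂`, which meet in two points, mirror images in the line `v₁v₂`. These are not congruent
placements, because a third vertex of `H` lies off that line. -/

/-! ### Derivations and automorphisms from algebraic independence -/

/-- In characteristic zero `K` is formally étale over the polynomial ring on the basis, so partial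
derivatives extend to `K`. -/
theorem IsTranscendenceBasis.exists_derivation {F K ι : Type*} [Field F] [CharZero F] [Field K]
    [Algebra F K] [DecidableEq ι] {b : ι → K} (hb : IsTranscendenceBasis F b) (i : ι) :
    ∃ D : Derivation F K K, ∀ j, D (b j) = if j = i then 1 else 0 := by
  let S := MvPolynomial ι F
  let : Algebra S K := (MvPolynomial.aeval b).toAlgebra
  have hS : ∀ s : S, algebraMap S K s = MvPolynomial.aeval b s := fun _ => rfl
  have : IsScalarTower F S K := IsScalarTower.of_algebraMap_eq fun r => by
    rw [hS, MvPolynomial.algebraMap_eq, MvPolynomial.aeval_C]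
  have : FaithfulSMul S K := (faithfulSMul_iff_algebraMap_injective S K).mpr hb.1
  let : Algebra (FractionRing S) K := FractionRing.liftAlgebra S K
  have : Algebra.IsAlgebraic S K := by
    constructor
    intro a
    obtain ⟨P, hP, hPa⟩ := hb.isAlgebraic.isAlgebraic a
    let e := hb.1.aevalEquiv
    refine ⟨P.map (e.symm : _ →+* S), ?_, ?_⟩
    · rwa [Ne, Polynomial.map_eq_zero_iff e.symm.injective]
    · rw [Polynomial.aeval_def, Polynomial.eval₂_map, ← hPa, Polynomial.aeval_def]
      congr 1
      ext c
      obtain ⟨m, rfl⟩ := e.surjective c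
      simp only [RingHom.comp_apply, RingHom.coe_coe, AlgEquiv.symm_apply_apply, hS]
      exact (hb.1.algebraMap_aevalEquiv m).symm
  have : Algebra.IsAlgebraic (FractionRing S) K :=
    Algebra.IsAlgebraic.extendScalars (R := S) (IsFractionRing.injective S (FractionRing S))
  have : CharZero (FractionRing S) := charZero_of_injective_algebraMap
    (IsFractionRing.injective S (FractionRing S))
  have : Algebra.FormallyEtale S (FractionRing S) :=
    Algebra.FormallyEtale.of_isLocalization (nonZeroDivisors S)
  have : Algebra.FormallyEtale (FractionRing S) K := Algebra.FormallyEtale.of_isSeparable _ K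
  have : Algebra.FormallyEtale S K := Algebra.FormallyEtale.comp S (FractionRing S) K
  let D₀ : Derivation F S K := MvPolynomial.mkDerivation F (Pi.single i 1)
  let ℓ : Ω[K⁄F] →ₗ[K] K := (D₀.liftKaehlerDifferential.liftBaseChange K) ∘ₗ
    (KaehlerDifferential.tensorKaehlerEquivOfFormallyEtale F S K).symm.toLinearMap
  refine ⟨ℓ.compDer (KaehlerDifferential.D F K), fun j => ?_⟩
  have : b j = algebraMap S K (MvPolynomial.X j) := by rw [hS, MvPolynomial.aeval_X]
  have hD : D₀ (MvPolynomial.X j) = if j = i then 1 else 0 :=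
    (MvPolynomial.mkDerivation_X _ _ _).trans (Pi.single_apply _ _ _)
  simpa [ℓ, this, KaehlerDifferential.tensorKaehlerEquivOfFormallyEtale_symm_D_algebraMap] using hD

theorem AlgebraicIndependent.exists_derivation {F K ι : Type*} [Field F] [CharZero F] [Field K]
    [Algebra F K] [DecidableEq ι] {b : ι → K} (hb : AlgebraicIndependent F b) (i : ι) :
    ∃ D : Derivation F K K, ∀ j, D (b j) = if j = i then 1 else 0 := by
  classical
  obtain ⟨s, hbs, hs⟩ := exists_isTranscendenceBasis_superset hb.coe_range
  obtain ⟨D, hD⟩ := hs.exists_derivation ⟨b i, hbs ⟨i, rfl⟩⟩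
  refine ⟨D, fun j => (hD ⟨b j, hbs ⟨j, rfl⟩⟩).trans ?_⟩
  simp [hb.injective.eq_iff]

/-- Transcendence bases containing the two families are equipotent and infinite, so the finite
matching extends to a bijection of bases; the resulting isomorphism of polynomial rings extends to
ℂ, an algebraic closure of both. -/
theorem AlgebraicIndependent.exists_ringEquiv {ι : Type*} [Finite ι] {x y : ι → ℂ}
    (hx : AlgebraicIndependent ℚ x) (hy : AlgebraicIndependent ℚ y) :
    ∃ σ : ℂ ≃+* ℂ, ∀ i, σ (x i) = y i := by
  obtain ⟨s, hxs, hs⟩ := exists_isTranscendenceBasis_superset hx.coe_range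
  obtain ⟨t, hyt, ht⟩ := exists_isTranscendenceBasis_superset hy.coe_range
  have hC : Cardinal.aleph0 < Cardinal.mk ℂ := by
    rw [Cardinal.mk_complex]; exact Cardinal.aleph0_lt_continuum
  have cs := IsAlgClosed.cardinal_eq_cardinal_transcendence_basis_of_aleph0_lt' _ hs
    (by simp) hC
  have ct := IsAlgClosed.cardinal_eq_cardinal_transcendence_basis_of_aleph0_lt' _ ht
    (by simp) hC
  have hst : Nonempty (s ≃ t) := Cardinal.eq.1 (cs.symm.trans ct)
  let x' : ι → s := fun i => ⟨x i, hxs ⟨i, rfl⟩⟩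
  let y' : ι → t := fun i => ⟨y i, hyt ⟨i, rfl⟩⟩
  have hx' : Function.Injective x' := fun i j h => hx.injective (congrArg Subtype.val h)
  have hy' : Function.Injective y' := fun i j h => hy.injective (congrArg Subtype.val h)
  let f : Set.range x' ↪ t :=
    ⟨fun a => y' ((Equiv.ofInjective x' hx').symm a), hy'.comp (Equiv.injective _)⟩
  obtain ⟨e, he⟩ := Cardinal.extend_function_of_lt f
    ((Cardinal.lt_aleph0_of_finite _).trans (cs ▸ hC)) hst
  have he' : ∀ i, e (x' i) = y' i := fun i => by
    rw [he ⟨x' i, i, rfl⟩]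
    simp only [f, Function.Embedding.coeFn_mk]
    congr 1
    exact Equiv.ofInjective_symm_apply hx' i
  let := IsAlgClosed.isAlgClosure_of_transcendence_basis _ hs
  let := IsAlgClosed.isAlgClosure_of_transcendence_basis _ ht
  let E := hs.1.aevalEquiv.symm.trans ((MvPolynomial.renameEquiv ℚ e).trans ht.1.aevalEquiv)
  refine ⟨IsAlgClosure.equivOfEquiv ℂ ℂ E.toRingEquiv, fun i => ?_⟩
  have h1 : x i = algebraMap (Algebra.adjoin ℚ (Set.range ((↑) : s → ℂ))) ℂ
      (hs.1.aevalEquiv (MvPolynomial.X (x' i))) := by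
    rw [hs.1.algebraMap_aevalEquiv]; simp [x']
  have h2 : E (hs.1.aevalEquiv (MvPolynomial.X (x' i))) =
      ht.1.aevalEquiv (MvPolynomial.X (y' i)) := by
    simp [E, he']
  rw [h1, IsAlgClosure.equivOfEquiv_algebraMap]
  change algebraMap _ ℂ (E _) = _
  rw [h2, ht.1.algebraMap_aevalEquiv]
  simp [y']

/-! ### Algebraic rigidity and its specialisations -/

/-- The generic realisation, whose coordinates are independent indeterminates over `ℚ`. -/
noncomputable def universalRealisation (V : Type*) (v : V) (i : Fin 2) :
    MvPolynomial (V × Fin 2) ℚ :=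
  MvPolynomial.X (v, i)

/-- The squared distance between the endpoints of `e` in the realisation `p`. -/
def edgeSq {V K : Type*} [CommRing K] (p : V → Fin 2 → K) (e : V × V) : K :=
  sqLen (p e.1 - p e.2)

/-- Evaluation of rational polynomials in the coordinates at the realisation `p`. -/
noncomputable def evalAt {V K : Type*} [CommRing K] [Algebra ℚ K] (p : V → Fin 2 → K) :
    MvPolynomial (V × Fin 2) ℚ →ₐ[ℚ] K :=
  MvPolynomial.aeval fun x => p x.1 x.2

/-- All squared distances in the generic realisation are algebraic over the subalgebra generated
by the squared edge lengths. -/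
def SimpleGraph.IsAlgebraicallyRigid {V : Type*} (G : SimpleGraph V) : Prop :=
  ∀ e : V × V, IsAlgebraic
    (Algebra.adjoin ℚ (edgeSq (universalRealisation V) '' {e | G.Adj e.1 e.2}))
    (edgeSq (universalRealisation V) e)

section Evaluation

variable {V K : Type*} [CommRing K]

section

variable [Algebra ℚ K]

@[simp]
theorem evalAt_universalRealisation (p : V → Fin 2 → K) (v : V) (i : Fin 2) :
    evalAt p (universalRealisation V v i) = p v i := by
  simp [evalAt, universalRealisation]

@[simp]
theorem evalAt_edgeSq (p : V → Fin 2 → K) (e : V × V) :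
    evalAt p (edgeSq (universalRealisation V) e) = edgeSq p e := by
  simp [edgeSq, sqLen]

end

theorem sqLen_sub_comm (P Q : Fin 2 → K) : sqLen (P - Q) = sqLen (Q - P) := by
  simp only [sqLen, Pi.sub_apply]; ring

theorem frameworkEquivalent_iff_edgeSq (G : SimpleGraph V) (p q : V → Fin 2 → K) :
    FrameworkEquivalent G p q ↔ ∀ e ∈ {e : V × V | G.Adj e.1 e.2}, edgeSq q e = edgeSq p e :=
  ⟨fun h e he => (h e.1 e.2 he).symm, fun h u v huv => (h (u, v) huv).symm⟩

/-- A nonzero polynomial in the coordinates which is algebraic over some squared distances takes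
finitely many values, all nonzero, on the realisations sharing these distances with a given
generic realisation. -/
theorem IsGeneric.finite_values {K : Type*} [Field K] [Algebra ℚ K] {p : V → Fin 2 → K}
    (hp : IsGeneric p) {S : Set (V × V)} {f : MvPolynomial (V × Fin 2) ℚ} (hf0 : f ≠ 0)
    (hf : IsAlgebraic (Algebra.adjoin ℚ (edgeSq (universalRealisation V) '' S)) f) :
    ∃ R : Finset K, 0 ∉ R ∧ ∀ q : V → Fin 2 → K, (∀ e ∈ S, edgeSq q e = edgeSq p e) →
      evalAt q f ∈ R := by
  classical
  set T := Algebra.adjoin ℚ (edgeSq (universalRealisation V) '' S)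
  -- A nonzero constant term is available because `f ≠ 0`; it keeps zero out of the root set.
  obtain ⟨P, hP0, hP⟩ :=
    hf.exists_nonzero_coeff_and_aeval_eq_zero (mem_nonZeroDivisors_of_ne_zero hf0)
  let φ : T →ₐ[ℚ] K := (evalAt p).comp T.val
  have hφ : Function.Injective φ := fun a b h => Subtype.ext (hp h)
  have h0 : (P.map (φ : T →+* K)).coeff 0 ≠ 0 := by
    rw [Polynomial.coeff_map]
    exact (map_ne_zero_iff _ hφ).2 hP0
  refine ⟨(P.map (φ : T →+* K)).roots.toFinset, ?_, fun q hq => ?_⟩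
  · simp only [Multiset.mem_toFinset, Polynomial.mem_roots', not_and]
    intro _ h
    rw [Polynomial.IsRoot, ← Polynomial.coeff_zero_eq_eval_zero] at h
    exact h0 h
  -- Evaluation at `q` and at `p` agree on the generators of `T`, so one specialised polynomial
  -- serves all `q`.
  · have hle : T ≤ AlgHom.equalizer (evalAt q) (evalAt p) := by
      refine Algebra.adjoin_le ?_
      rintro _ ⟨e, he, rfl⟩
      simp [hq e he]
    have hφq : (φ : T →+* K) = ((evalAt q : MvPolynomial (V × Fin 2) ℚ →+* K)).comp (algebraMap T _) := by
      ext c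
      exact (hle c.2).symm
    rw [Multiset.mem_toFinset, Polynomial.mem_roots (fun h => h0 (by simp [h])),
      Polynomial.IsRoot, Polynomial.eval_map, hφq]
    have := congrArg (evalAt q) hP
    rw [Polynomial.aeval_def, map_zero] at this
    rw [← this]
    exact (Polynomial.hom_eval₂ _ _ (evalAt q : MvPolynomial (V × Fin 2) ℚ →+* K) _).symm

end Evaluation

theorem edgeSq_universalRealisation_ne_zero {V : Type*} {u v : V} (h : u ≠ v) :
    edgeSq (universalRealisation V) (u, v) ≠ 0 := by
  classical
  intro h0
  have := congrArg (evalAt (fun w (i : Fin 2) => if w = u ∧ i = 0 then (1 : ℚ) else 0)) h0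
  simp [edgeSq, sqLen, h.symm] at this

/-- The determinant of the vectors `Q - P` and `R - P`. -/
def signedArea {K : Type*} [CommRing K] (P Q R : Fin 2 → K) : K :=
  (Q 0 - P 0) * (R 1 - P 1) - (Q 1 - P 1) * (R 0 - P 0)

theorem evalAt_signedArea {V K : Type*} [CommRing K] [Algebra ℚ K] (q : V → Fin 2 → K)
    (u v w : V) : evalAt q (signedArea (universalRealisation V u) (universalRealisation V v)
      (universalRealisation V w)) = signedArea (q u) (q v) (q w) := by
  simp [signedArea]

theorem signedArea_universalRealisation_ne_zero {V : Type*} {u v w : V} (huv : u ≠ v)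
    (huw : u ≠ w) (hvw : v ≠ w) :
    signedArea (universalRealisation V u) (universalRealisation V v)
      (universalRealisation V w) ≠ 0 := by
  classical
  intro h0
  have := congrArg (evalAt (fun x (i : Fin 2) =>
    if x = v ∧ i = 0 then (1 : ℚ) else if x = w ∧ i = 1 then 1 else 0)) h0
  rw [evalAt_signedArea] at this
  simp [signedArea, huv, huw, hvw, hvw.symm] at this

/-- A Gram determinant identity in the plane. -/
theorem four_mul_signedArea_mul_signedArea {K : Type*} [CommRing K] (P Q A B : Fin 2 → K) :
    4 * (signedArea P Q A * signedArea P Q B) =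
      2 * sqLen (P - Q) * (sqLen (A - P) + sqLen (B - P) - sqLen (A - B)) -
      (sqLen (P - Q) + sqLen (A - P) - sqLen (A - Q)) *
        (sqLen (P - Q) + sqLen (B - P) - sqLen (B - Q)) := by
  simp only [signedArea, sqLen, Pi.sub_apply]; ring

namespace SimpleGraph.IsAlgebraicallyRigid

variable {V K : Type*} [Field K] [Algebra ℚ K] {G : SimpleGraph V} {p q : V → Fin 2 → K}

theorem sqLen_ne_zero (hG : G.IsAlgebraicallyRigid) (hp : IsGeneric p)
    (hq : FrameworkEquivalent G p q) {u v : V} (h : u ≠ v) : sqLen (q u - q v) ≠ 0 := by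
  obtain ⟨R, h0, hR⟩ := hp.finite_values (edgeSq_universalRealisation_ne_zero h) (hG (u, v))
  have := hR q ((frameworkEquivalent_iff_edgeSq G p q).1 hq)
  rw [evalAt_edgeSq] at this
  exact fun h => h0 (h ▸ this)

theorem signedArea_ne_zero (hG : G.IsAlgebraicallyRigid) (hp : IsGeneric p)
    (hq : FrameworkEquivalent G p q) {u v w : V} (huv : u ≠ v) (huw : u ≠ w) (hvw : v ≠ w) :
    signedArea (q u) (q v) (q w) ≠ 0 := by
  let f := signedArea (universalRealisation V u) (universalRealisation V v)
    (universalRealisation V w)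
  have hf0 : f ≠ 0 := signedArea_universalRealisation_ne_zero huv huw hvw
  -- The area is not a polynomial in squared distances, but by the Gram identity four times its
  -- square is.
  have hf : 4 * (f * f) ≠ 0 := mul_ne_zero (by norm_num) (mul_ne_zero hf0 hf0)
  have halg : IsAlgebraic (Algebra.adjoin ℚ
      (edgeSq (universalRealisation V) '' {e | G.Adj e.1 e.2})) (4 * (f * f)) := by
    rw [four_mul_signedArea_mul_signedArea]
    have d : ∀ a b : V, IsAlgebraic (Algebra.adjoin ℚ
        (edgeSq (universalRealisation V) '' {e | G.Adj e.1 e.2}))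
        (sqLen (universalRealisation V a - universalRealisation V b)) := fun a b => hG (a, b)
    exact (((isAlgebraic_natCast 2).mul (d _ _)).mul (((d _ _).add (d _ _)).sub (d _ _))).sub
      ((((d _ _).add (d _ _)).sub (d _ _)).mul (((d _ _).add (d _ _)).sub (d _ _)))
  obtain ⟨R, h0, hR⟩ := hp.finite_values hf halg
  have := hR q ((frameworkEquivalent_iff_edgeSq G p q).1 hq)
  rw [map_mul, map_mul, evalAt_signedArea] at this
  intro h
  rw [h] at this
  simp only [mul_zero] at this
  exact h0 this

end SimpleGraph.IsAlgebraicallyRigid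

/-! ### Finiteness and constancy of the number of classes -/

theorem SimpleGraph.IsAlgebraicallyRigid.finite_congruenceClasses {V : Type*} [Finite V]
    {G : SimpleGraph V} (hG : G.IsAlgebraicallyRigid) {p : V → Fin 2 → ℂ} (hp : IsGeneric p) :
    Finite (CongruenceClasses G p) := by
  have key : ∀ e : V × V, ∃ R : Finset ℂ, ∀ q, FrameworkEquivalent G p q → edgeSq q e ∈ R := by
    rintro ⟨u, v⟩
    by_cases h : u = v
    · exact ⟨{0}, fun q _ => by simp [edgeSq, sqLen, h]⟩
    · obtain ⟨R, -, hR⟩ := hp.finite_values (edgeSq_universalRealisation_ne_zero h) (hG (u, v))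
      refine ⟨R, fun q hq => ?_⟩
      have := hR q ((frameworkEquivalent_iff_edgeSq G p q).1 hq)
      rwa [evalAt_edgeSq] at this
  choose R hR using key
  let F : CongruenceClasses G p → ∀ e : V × V, R e :=
    Quotient.lift (fun q e => ⟨edgeSq q.1 e, hR e q.1 q.2⟩)
      (fun q q' h => funext fun e => Subtype.ext (h e.1 e.2))
  refine Finite.of_injective F fun c c' => ?_
  induction c, c' using Quotient.inductionOn₂ with
  | h q q' =>
    intro h
    exact Quotient.sound fun u v => congrArg Subtype.val (congrFun h (u, v))

theorem sqLen_map {K L : Type*} [CommRing K] [CommRing L] (σ : K →+* L) (P Q : Fin 2 → K) :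
    sqLen ((fun i => σ (P i)) - fun i => σ (Q i)) = σ (sqLen (P - Q)) := by
  simp [sqLen]

/-- A field automorphism carrying `p` to `p'` identifies the congruence classes. -/
theorem card_congruenceClasses_eq_of_ringEquiv {V : Type*} (G : SimpleGraph V)
    {p p' : V → Fin 2 → ℂ} (σ : ℂ ≃+* ℂ) (h : ∀ v i, σ (p v i) = p' v i) :
    Nat.card (CongruenceClasses G p) = Nat.card (CongruenceClasses G p') := by
  obtain rfl : (fun v i => σ (p v i)) = p' := funext fun v => funext fun i => h v i
  let e : (V → Fin 2 → ℂ) ≃ (V → Fin 2 → ℂ) :=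
    Equiv.piCongrRight fun _ => Equiv.piCongrRight fun _ => σ.toEquiv
  have he : ∀ (q : V → Fin 2 → ℂ) (u v : V), sqLen (e q u - e q v) = σ (sqLen (q u - q v)) :=
    fun q u v => sqLen_map (σ : ℂ →+* ℂ) (q u) (q v)
  refine Nat.card_congr (Quotient.congr (e.subtypeEquiv fun q => ?_) fun q q' => ?_)
  · refine forall₂_congr fun u v => imp_congr_right fun _ => ?_
    change _ ↔ sqLen (e p u - e p v) = _
    rw [he, he]
    exact σ.injective.eq_iff.symm
  · refine forall₂_congr fun u v => ?_
    change _ ↔ sqLen (e q.1 u - e q.1 v) = sqLen (e q'.1 u - e q'.1 v)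
    rw [he, he]
    exact σ.injective.eq_iff.symm

theorem SimpleGraph.IsAlgebraicallyRigid.isRealisationNumber {V : Type*} [Finite V]
    {G : SimpleGraph V} (hG : G.IsAlgebraicallyRigid) {p : V → Fin 2 → ℂ} (hp : IsGeneric p) :
    IsRealisationNumber G (Nat.card (CongruenceClasses G p)) := by
  refine fun p' hp' => ⟨hG.finite_congruenceClasses hp', ?_⟩
  obtain ⟨σ, hσ⟩ := AlgebraicIndependent.exists_ringEquiv hp' hp
  exact card_congruenceClasses_eq_of_ringEquiv G σ fun v i => hσ (v, i)

theorem IsRealisationNumber.realisationNumber {V : Type*} {G : SimpleGraph V} {k : ℕ}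
    (h : IsRealisationNumber G k) : IsRealisationNumber G (realisationNumber G) := by
  have h' : ∃ k, IsRealisationNumber G k := ⟨k, h⟩
  rw [_root_.realisationNumber, dif_pos h']
  exact h'.choose_spec

/-! ### From rigidity to algebraic rigidity -/

theorem continuous_edgeSq {V : Type*} (e : V × V) :
    Continuous fun q : V → Fin 2 → ℝ => edgeSq q e := by
  simp only [edgeSq, sqLen, Pi.sub_apply]; fun_prop

theorem isRigidFramework_iff_eventually {V : Type*} [Finite V] (G : SimpleGraph V)
    (p : V → Fin 2 → ℝ) :
    IsRigidFramework G p ↔ ∀ᶠ q in 𝓝 p, FrameworkEquivalent G p q → FrameworkCongruent p q := by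
  have := Fintype.ofFinite V
  constructor
  · rintro ⟨ε, hε, h⟩
    have hc : ∀ v, ∀ᶠ q in 𝓝 p, sqLen (p v - q v) < ε := fun v => by
      have : Continuous fun q : V → Fin 2 → ℝ => sqLen (p v - q v) := by
        simp only [sqLen, Pi.sub_apply]; fun_prop
      refine this.continuousAt.eventually_lt continuousAt_const ?_
      simpa [sqLen] using hε
    filter_upwards [eventually_all.2 hc] with q hq hpq using h q hpq hq
  · intro h
    obtain ⟨δ, hδ, h⟩ := Metric.eventually_nhds_iff.1 h
    refine ⟨δ ^ 2, by positivity, fun q hpq hq => h ?_ hpq⟩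
    rw [dist_pi_lt_iff hδ]
    intro v
    rw [dist_pi_lt_iff hδ]
    intro i
    rw [Real.dist_eq, abs_sub_comm]
    refine abs_lt_of_sq_lt_sq (lt_of_le_of_lt ?_ (hq v)) hδ.le
    fin_cases i
    · simpa [sqLen] using sq_nonneg (p v 1 - q v 1)
    · simpa [sqLen] using sq_nonneg (p v 0 - q v 0)

/-- The derivative at `p` of the squared length of `e`: a row of the rigidity matrix. -/
noncomputable def edgeDeriv {V : Type*} (p : V → Fin 2 → ℝ) (e : V × V) :
    (V → Fin 2 → ℝ) →L[ℝ] ℝ :=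
  let x (v : V) (i : Fin 2) : (V → Fin 2 → ℝ) →L[ℝ] ℝ :=
    (ContinuousLinearMap.proj (R := ℝ) (φ := fun _ : Fin 2 => ℝ) i).comp
      (ContinuousLinearMap.proj (φ := fun _ : V => Fin 2 → ℝ) v)
  (2 * (p e.1 0 - p e.2 0)) • (x e.1 0 - x e.2 0) + (2 * (p e.1 1 - p e.2 1)) • (x e.1 1 - x e.2 1)

theorem edgeDeriv_apply {V : Type*} (p q : V → Fin 2 → ℝ) (e : V × V) :
    edgeDeriv p e q = 2 * (p e.1 0 - p e.2 0) * (q e.1 0 - q e.2 0) +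
      2 * (p e.1 1 - p e.2 1) * (q e.1 1 - q e.2 1) := by
  simp [edgeDeriv]

theorem hasStrictFDerivAt_edgeSq {V : Type*} [Finite V] (p : V → Fin 2 → ℝ) (e : V × V) :
    HasStrictFDerivAt (fun q : V → Fin 2 → ℝ => edgeSq q e) (edgeDeriv p e) p := by
  have := Fintype.ofFinite V
  let x (v : V) (i : Fin 2) : (V → Fin 2 → ℝ) →L[ℝ] ℝ :=
    (ContinuousLinearMap.proj (R := ℝ) (φ := fun _ : Fin 2 => ℝ) i).comp
      (ContinuousLinearMap.proj (φ := fun _ : V => Fin 2 → ℝ) v)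
  have h := ((x e.1 0 - x e.2 0).hasStrictFDerivAt (x := p)).pow 2 |>.add
    (((x e.1 1 - x e.2 1).hasStrictFDerivAt (x := p)).pow 2)
  convert! h using 1
  ext q
  simp [edgeDeriv_apply, x]

theorem Derivation.apply_edgeSq {V : Type*} (D : Derivation ℚ ℝ ℝ) (p : V → Fin 2 → ℝ)
    (e : V × V) : D (edgeSq p e) = edgeDeriv p e fun v i => D (p v i) := by
  simp [edgeSq, sqLen, edgeDeriv_apply, Derivation.leibniz_pow]
  ring

/-- Algebraically independent squared distances form a submersion. -/
theorem surjective_pi_edgeDeriv {V : Type*} [Finite V] {p : V → Fin 2 → ℝ} {B : Set (V × V)}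
    (hB : AlgebraicIndependent ℚ fun e : B => edgeSq p e) :
    Function.Surjective (ContinuousLinearMap.pi fun e : B => edgeDeriv p e) := by
  classical
  have := Fintype.ofFinite V
  -- Applying the dual derivations to the coordinates of `p` gives, by the Leibniz rule, preimages
  -- of the standard basis vectors.
  choose D hD using hB.exists_derivation
  intro w
  refine ⟨∑ j, w j • fun v i => D j (p v i), ?_⟩
  ext b
  simp only [map_sum, map_smul, Finset.sum_apply, Pi.smul_apply, ContinuousLinearMap.coe_pi',
    ← Derivation.apply_edgeSq, hD, smul_eq_mul, mul_ite, mul_one, mul_zero]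
  simp

/-- Suppose the distance `d` is transcendental over the edges, and let `B` be a maximal independent
set of edges. The squared lengths of `B ∪ {d}` form a submersion at `p`, so `d` can vary near `p`
with `B` fixed. The other edges, algebraic over `B`, take finitely many values and stay constant
near `p`, contradicting rigidity. -/
theorem IsRigidFramework.isAlgebraicallyRigid {V : Type*} [Finite V] {G : SimpleGraph V}
    {p : V → Fin 2 → ℝ} (hp : IsGeneric p) (h : IsRigidFramework G p) :
    G.IsAlgebraicallyRigid := by
  classical
  have := Fintype.ofFinite V
  intro d
  by_contra hd
  set S : Set (V × V) := {e | G.Adj e.1 e.2}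
  let X := edgeSq (universalRealisation V)
  obtain ⟨B, ⟨hBS, hB⟩, hmax⟩ : ∃ B, Maximal (fun B => B ⊆ S ∧ AlgebraicIndepOn ℚ X B) B :=
    (Set.toFinite _).exists_maximal ⟨∅, Set.empty_subset _,
      (algebraicIndependent_empty_type_iff).2 (algebraMap ℚ _).injective⟩
  have halg : ∀ e ∈ S, IsAlgebraic (Algebra.adjoin ℚ (X '' B)) (X e) := fun e he => by
    by_contra hne
    have := hmax ⟨Set.insert_subset he hBS, hB.insert hne⟩ (Set.subset_insert e B)
    exact hne (isAlgebraic_algebraMap (⟨X e, Algebra.subset_adjoin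
      ⟨e, this (Set.mem_insert _ _), rfl⟩⟩ : Algebra.adjoin ℚ (X '' B)))
  have hdB : ¬ IsAlgebraic (Algebra.adjoin ℚ (X '' B)) (X d) := fun hd' =>
    hd (hd'.adjoin_of_forall_isAlgebraic fun s hs => absurd (Set.image_mono hBS hs.1) hs.2)
  have hdB' : d ∉ B := fun hdm => hdB (isAlgebraic_algebraMap (⟨X d, Algebra.subset_adjoin
      ⟨d, hdm, rfl⟩⟩ : Algebra.adjoin ℚ (X '' B)))
  have hI : AlgebraicIndependent ℚ fun e : (insert d B : Set (V × V)) => edgeSq p e := by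
    have := (hB.insert hdB).map' (f := evalAt p) hp
    convert this using 1
    ext e
    simp [X]
  have hF : HasStrictFDerivAt (fun q (e : (insert d B : Set (V × V))) => edgeSq q e.1)
      (ContinuousLinearMap.pi fun e : (insert d B : Set (V × V)) => edgeDeriv p e) p :=
    hasStrictFDerivAt_pi.2 fun e => hasStrictFDerivAt_edgeSq p e
  have hopen := hF.map_nhds_eq_of_surj (LinearMap.range_eq_top.2 (surjective_pi_edgeDeriv hI))
  have hfin : ∀ e ∈ S, ∃ R : Finset ℝ, ∀ q : V → Fin 2 → ℝ, (∀ b ∈ B, edgeSq q b = edgeSq p b) →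
      edgeSq q e ∈ R := fun e he => by
    obtain ⟨R, -, hR⟩ := hp.finite_values
      (edgeSq_universalRealisation_ne_zero (u := e.1) (v := e.2) (G.ne_of_adj he)) (halg e he)
    exact ⟨R, fun q hq => by simpa using hR q hq⟩
  choose! R hR using hfin
  -- For `e ∉ S` the set `R e` is an arbitrary default; only its finiteness matters.
  have hU : ∀ᶠ q in 𝓝 p, (FrameworkEquivalent G p q → FrameworkCongruent p q) ∧
      ∀ e, edgeSq q e ∉ (R e).erase (edgeSq p e) := by
    refine ((isRigidFramework_iff_eventually G p).1 h).and (eventually_all.2 fun e => ?_)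
    exact (continuous_edgeSq e).continuousAt.eventually
      (((R e).erase (edgeSq p e)).finite_toSet.isClosed.isOpen_compl.mem_nhds (by simp))
  have himg := image_mem_map (m := fun q (e : (insert d B : Set (V × V))) => edgeSq q e.1) hU
  rw [hopen] at himg
  have hline : Tendsto (fun t : ℝ => fun e : (insert d B : Set (V × V)) =>
      edgeSq p e.1 + if e.1 = d then t else 0) (𝓝[≠] 0)
      (𝓝 fun e : (insert d B : Set (V × V)) => edgeSq p e.1) := by
    refine tendsto_nhdsWithin_of_tendsto_nhds ?_
    have hc : Continuous (fun t : ℝ => fun e : (insert d B : Set (V × V)) =>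
        edgeSq p e.1 + if e.1 = d then t else 0) := by
      refine continuous_pi fun e => ?_
      split_ifs <;> fun_prop
    simpa using hc.tendsto 0
  obtain ⟨t, ⟨q, ⟨hq1, hq2⟩, hq⟩, ht⟩ := ((hline.eventually himg).and self_mem_nhdsWithin).exists
  have hqB : ∀ b ∈ B, edgeSq q b = edgeSq p b := fun b hb => by
    have := congrFun hq ⟨b, Set.mem_insert_of_mem _ hb⟩
    have hbd : b ≠ d := fun h => hdB' (h ▸ hb)
    simpa [hbd] using this
  have hqd : edgeSq q d = edgeSq p d + t := by
    simpa using congrFun hq ⟨d, Set.mem_insert _ _⟩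
  have hcong := hq1 ((frameworkEquivalent_iff_edgeSq G p q).2 fun e he => by
    by_contra hne
    exact hq2 e (Finset.mem_erase.2 ⟨hne, hR e he q hqB⟩)) d.1 d.2
  refine ht ?_
  have : edgeSq p d = edgeSq q d := hcong
  simp only [Set.mem_singleton_iff]
  linarith

/-! ### Intersecting two circles, and removing a vertex -/

section CirclePoint

variable {K : Type*} [Field K]

/-- The coordinate along `Q - P` of the points at squared distances `a` from `P` and `b`
from `Q`. -/
def circleCoord (P Q : Fin 2 → K) (a b : K) : K :=
  (a - b + sqLen (P - Q)) / (2 * sqLen (P - Q))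

/-- The point with coordinates `circleCoord P Q a b` and `β` in the frame at `P` given by `Q - P`
and its rotation by a right angle. -/
def circlePoint (P Q : Fin 2 → K) (a b β : K) : Fin 2 → K :=
  ![P 0 + circleCoord P Q a b * (Q 0 - P 0) - β * (Q 1 - P 1),
    P 1 + circleCoord P Q a b * (Q 1 - P 1) + β * (Q 0 - P 0)]

variable {P Q : Fin 2 → K} {a b β : K}

/-- The frame vectors are orthogonal of squared length `sqLen (P - Q)`, so the condition on `β` is
Pythagoras. -/
theorem sqLen_circlePoint_sub_left (h : sqLen (P - Q) ≠ 0)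
    (hβ : β ^ 2 = a / sqLen (P - Q) - circleCoord P Q a b ^ 2) :
    sqLen (circlePoint P Q a b β - P) = a := by
  have h1 : sqLen (circlePoint P Q a b β - P) =
      (circleCoord P Q a b ^ 2 + β ^ 2) * sqLen (P - Q) := by
    simp [sqLen, circlePoint]; ring
  rw [h1, hβ]
  field_simp
  ring

theorem sqLen_circlePoint_sub_right [NeZero (2 : K)] (h : sqLen (P - Q) ≠ 0)
    (hβ : β ^ 2 = a / sqLen (P - Q) - circleCoord P Q a b ^ 2) :
    sqLen (circlePoint P Q a b β - Q) = b := by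
  have h1 : sqLen (circlePoint P Q a b β - Q) = sqLen (circlePoint P Q a b β - P) -
      2 * circleCoord P Q a b * sqLen (P - Q) + sqLen (P - Q) := by
    simp [sqLen, circlePoint]; ring
  have h2 : (2 : K) ≠ 0 := two_ne_zero
  rw [h1, sqLen_circlePoint_sub_left h hβ, circleCoord]
  field_simp
  ring

theorem signedArea_circlePoint :
    signedArea P Q (circlePoint P Q a b β) = β * sqLen (P - Q) := by
  simp [signedArea, sqLen, circlePoint]; ring

theorem circlePoint_of_sqLen [NeZero (2 : K)] (h : sqLen (P - Q) ≠ 0) (X : Fin 2 → K) :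
    circlePoint P Q (sqLen (X - P)) (sqLen (X - Q)) (signedArea P Q X / sqLen (P - Q)) = X := by
  have h2 : (2 : K) ≠ 0 := two_ne_zero
  have h' : (P 0 - Q 0) ^ 2 + (P 1 - Q 1) ^ 2 ≠ 0 := h
  funext i
  fin_cases i <;> simp [circlePoint, circleCoord, signedArea, sqLen] <;> field_simp <;> ring

theorem sq_signedArea_div [NeZero (2 : K)] (h : sqLen (P - Q) ≠ 0) (X : Fin 2 → K) :
    (signedArea P Q X / sqLen (P - Q)) ^ 2 =
      sqLen (X - P) / sqLen (P - Q) - circleCoord P Q (sqLen (X - P)) (sqLen (X - Q)) ^ 2 := by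
  have h2 : (2 : K) ≠ 0 := two_ne_zero
  have h' : (P 0 - Q 0) ^ 2 + (P 1 - Q 1) ^ 2 ≠ 0 := h
  simp [circleCoord, signedArea, sqLen]
  field_simp
  ring

end CirclePoint

section Extend

variable {V K : Type*} {vn : V}

open Classical in
/-- Extend a realisation of the complement of `vn` by placing `vn` at `x`. -/
noncomputable def extendRealisation (q : ({vn}ᶜ : Set V) → Fin 2 → K) (x : Fin 2 → K) :
    V → Fin 2 → K :=
  fun v => if h : v = vn then x else q ⟨v, h⟩

@[simp]
theorem extendRealisation_self (q : ({vn}ᶜ : Set V) → Fin 2 → K) (x : Fin 2 → K) :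
    extendRealisation q x vn = x := by
  simp [extendRealisation]

@[simp]
theorem extendRealisation_coe (q : ({vn}ᶜ : Set V) → Fin 2 → K) (x : Fin 2 → K)
    (v : ({vn}ᶜ : Set V)) : extendRealisation q x v = q v :=
  dif_neg v.2

theorem extendRealisation_restrict (p : V → Fin 2 → K) :
    extendRealisation (fun v : ({vn}ᶜ : Set V) => p v) (p vn) = p := by
  funext v
  by_cases h : v = vn
  · subst h; simp
  · exact dif_neg h

variable [CommRing K]

theorem frameworkEquivalent_iff_induce_compl {G : SimpleGraph V} {v₁ v₂ : V}
    (hN : G.neighborSet vn = {v₁, v₂}) (p q : V → Fin 2 → K) :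
    FrameworkEquivalent G p q ↔
      FrameworkEquivalent (G.induce ({vn}ᶜ : Set V)) (fun v => p v) (fun v => q v) ∧
      sqLen (p vn - p v₁) = sqLen (q vn - q v₁) ∧ sqLen (p vn - p v₂) = sqLen (q vn - q v₂) := by
  have hadj : ∀ u, G.Adj vn u ↔ u = v₁ ∨ u = v₂ := fun u => by
    rw [← SimpleGraph.mem_neighborSet, hN]; simp
  refine ⟨fun h => ⟨fun u v huv => h u v huv, h _ _ ((hadj _).2 (.inl rfl)),
    h _ _ ((hadj _).2 (.inr rfl))⟩, ?_⟩
  rintro ⟨h, h₁, h₂⟩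
  have hn : ∀ u, G.Adj vn u → sqLen (p vn - p u) = sqLen (q vn - q u) := fun u hu => by
    rcases (hadj u).1 hu with rfl | rfl <;> assumption
  intro u v huv
  by_cases hu : u = vn
  · exact hu ▸ hn v (hu ▸ huv)
  · by_cases hv : v = vn
    · rw [sqLen_sub_comm (p u), sqLen_sub_comm (q u)]
      exact hv ▸ hn u (hv ▸ huv.symm)
    · exact h ⟨u, hu⟩ ⟨v, hv⟩ huv

theorem frameworkCongruent_iff_compl (p q : V → Fin 2 → K) :
    FrameworkCongruent p q ↔
      FrameworkCongruent (fun v : ({vn}ᶜ : Set V) => p v) (fun v => q v) ∧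
      ∀ u : ({vn}ᶜ : Set V), sqLen (p vn - p u) = sqLen (q vn - q u) := by
  refine ⟨fun h => ⟨fun u v => h u v, fun u => h vn u⟩, ?_⟩
  rintro ⟨h, hn⟩ u v
  by_cases hu : u = vn
  · by_cases hv : v = vn
    · simp [hu, hv, sqLen]
    · exact hu ▸ hn ⟨v, hv⟩
  · by_cases hv : v = vn
    · rw [sqLen_sub_comm (p u), sqLen_sub_comm (q u)]
      exact hv ▸ hn ⟨u, hu⟩
    · exact h ⟨u, hu⟩ ⟨v, hv⟩

theorem IsGeneric.restrict [Algebra ℚ K] {p : V → Fin 2 → K} (hp : IsGeneric p) (s : Set V) :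
    IsGeneric fun v : s => p v :=
  hp.comp (fun x : s × Fin 2 => (x.1.1, x.2)) fun x y h => by
    simp only [Prod.mk.injEq] at h
    exact Prod.ext (Subtype.ext h.1) h.2

end Extend

theorem continuousAt_circlePoint {X : Type*} [TopologicalSpace X] {P Q : X → Fin 2 → ℝ}
    {β : X → ℝ} {x : X} (a b : ℝ) (hP : ContinuousAt P x) (hQ : ContinuousAt Q x)
    (hβ : ContinuousAt β x) (h : sqLen (P x - Q x) ≠ 0) :
    ContinuousAt (fun y => circlePoint (P y) (Q y) a b (β y)) x := by
  have hP' := continuousAt_pi.1 hP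
  have hQ' := continuousAt_pi.1 hQ
  have hD : ContinuousAt (fun y => sqLen (P y - Q y)) x := by
    simp only [sqLen, Pi.sub_apply]
    exact (((hP' 0).sub (hQ' 0)).pow 2).add (((hP' 1).sub (hQ' 1)).pow 2)
  have hα : ContinuousAt (fun y => circleCoord (P y) (Q y) a b) x :=
    (continuousAt_const.add hD).div (continuousAt_const.mul hD) (mul_ne_zero two_ne_zero h)
  refine continuousAt_pi.2 fun i => ?_
  fin_cases i
  · exact ((hP' 0).add (hα.mul ((hQ' 0).sub (hP' 0)))).sub (hβ.mul ((hQ' 1).sub (hP' 1)))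
  · exact ((hP' 1).add (hα.mul ((hQ' 1).sub (hP' 1)))).add (hβ.mul ((hQ' 0).sub (hP' 0)))

theorem IsGeneric.real_sqLen_ne_zero {V : Type*} {p : V → Fin 2 → ℝ} (hp : IsGeneric p)
    {u v : V} (h : u ≠ v) : sqLen (p u - p v) ≠ 0 := by
  have := (map_ne_zero_iff (evalAt p) hp).2 (edgeSq_universalRealisation_ne_zero h)
  rwa [evalAt_edgeSq] at this

theorem IsGeneric.signedArea_ne_zero {V : Type*} {p : V → Fin 2 → ℝ} (hp : IsGeneric p)
    {u v w : V} (huv : u ≠ v) (huw : u ≠ w) (hvw : v ≠ w) :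
    signedArea (p u) (p v) (p w) ≠ 0 := by
  have := (map_ne_zero_iff (evalAt p) hp).2 (signedArea_universalRealisation_ne_zero huv huw hvw)
  rwa [evalAt_signedArea] at this

/-- For `q` near `pH`, placing `vn` at the intersection of the circles on its original side extends
`q` to a realisation near `p`, to which rigidity of `G` applies. -/
theorem IsRigidFramework.induce_compl {V : Type*} [Finite V] {G : SimpleGraph V} {vn v₁ v₂ : V}
    (h₁₂ : v₁ ≠ v₂) (hN : G.neighborSet vn = {v₁, v₂}) {p : V → Fin 2 → ℝ} (hp : IsGeneric p)
    (h : IsRigidFramework G p) :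
    IsRigidFramework (G.induce ({vn}ᶜ : Set V)) fun v => p v := by
  have hv₁ : v₁ ≠ vn := (G.ne_of_adj (show v₁ ∈ G.neighborSet vn by simp [hN])).symm
  have hv₂ : v₂ ≠ vn := (G.ne_of_adj (show v₂ ∈ G.neighborSet vn by simp [hN])).symm
  let w₁ : ({vn}ᶜ : Set V) := ⟨v₁, hv₁⟩
  let w₂ : ({vn}ᶜ : Set V) := ⟨v₂, hv₂⟩
  rw [isRigidFramework_iff_eventually] at h ⊢
  set pH : ({vn}ᶜ : Set V) → Fin 2 → ℝ := fun v => p v with hpH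
  have hD : sqLen (pH w₁ - pH w₂) ≠ 0 := hp.real_sqLen_ne_zero h₁₂
  have hS : signedArea (pH w₁) (pH w₂) (p vn) ≠ 0 := hp.signedArea_ne_zero h₁₂ hv₁ hv₂
  set a := sqLen (p vn - pH w₁)
  set b := sqLen (p vn - pH w₂)
  let r (q : ({vn}ᶜ : Set V) → Fin 2 → ℝ) : ℝ :=
    a / sqLen (q w₁ - q w₂) - circleCoord (q w₁) (q w₂) a b ^ 2
  -- The sign selects the side of the line on which `p vn` lies.
  let s : ℝ := SignType.sign (signedArea (pH w₁) (pH w₂) (p vn) / sqLen (pH w₁ - pH w₂))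
  let x (q : ({vn}ᶜ : Set V) → Fin 2 → ℝ) : Fin 2 → ℝ :=
    circlePoint (q w₁) (q w₂) a b (s * √(r q))
  have hcD : Continuous fun q : ({vn}ᶜ : Set V) → Fin 2 → ℝ => sqLen (q w₁ - q w₂) := by
    simp only [sqLen, Pi.sub_apply]; fun_prop
  have hr : r pH = (signedArea (pH w₁) (pH w₂) (p vn) / sqLen (pH w₁ - pH w₂)) ^ 2 :=
    (sq_signedArea_div hD (p vn)).symm
  have hr0 : 0 < r pH := by rw [hr]; positivity
  have hs2 : s ^ 2 = 1 := by
    rcases (div_ne_zero hS hD).lt_or_gt with h | h <;> simp [s, h]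
  have hx : x pH = p vn := by
    simp only [x, hr, Real.sqrt_sq_eq_abs, s, sign_mul_abs]
    exact circlePoint_of_sqLen hD (p vn)
  have hcr : ContinuousAt r pH := by
    refine (continuousAt_const.div hcD.continuousAt hD).sub (ContinuousAt.pow ?_ 2)
    exact ((continuous_const.add hcD).continuousAt).div (continuous_const.mul hcD).continuousAt
      (mul_ne_zero two_ne_zero hD)
  have hcx : ContinuousAt x pH :=
    continuousAt_circlePoint a b (continuous_apply w₁).continuousAt
      (continuous_apply w₂).continuousAt (continuousAt_const.mul hcr.sqrt) hD
  have hce : Tendsto (fun q => extendRealisation q (x q)) (𝓝 pH) (𝓝 p) := by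
    have : ContinuousAt (fun q => extendRealisation q (x q)) pH := by
      refine continuousAt_pi.2 fun v => ?_
      by_cases hv : v = vn
      · subst hv; simpa using hcx
      · have : ∀ q, extendRealisation q (x q) v = q ⟨v, hv⟩ := fun q => dif_neg hv
        simp only [this]
        exact (continuous_apply _).continuousAt
    rw [ContinuousAt, hx, hpH, extendRealisation_restrict] at this
    exact this
  filter_upwards [hce.eventually h, hcD.continuousAt.eventually_ne hD,
    hcr.eventually_const_lt hr0] with q hq hqD hqr hequiv
  have hβ : (s * √(r q)) ^ 2 = a / sqLen (q w₁ - q w₂) - circleCoord (q w₁) (q w₂) a b ^ 2 := by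
    rw [mul_pow, hs2, one_mul, Real.sq_sqrt hqr.le]
  have e₁ : extendRealisation q (x q) v₁ = q w₁ := extendRealisation_coe q _ w₁
  have e₂ : extendRealisation q (x q) v₂ = q w₂ := extendRealisation_coe q _ w₂
  have := hq ((frameworkEquivalent_iff_induce_compl hN _ _).2 ⟨by simpa using hequiv, by
    rw [e₁, extendRealisation_self]
    exact (sqLen_circlePoint_sub_left hqD hβ).symm, by
    rw [e₂, extendRealisation_self]
    exact (sqLen_circlePoint_sub_right hqD hβ).symm⟩)
  simpa using ((frameworkCongruent_iff_compl (vn := vn) _ _).1 this).1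

/-! ### Restriction of classes is two-to-one -/

theorem IsGeneric.ofReal {V : Type*} {p : V → Fin 2 → ℝ} (hp : IsGeneric p) :
    IsGeneric fun v i => (p v i : ℂ) :=
  AlgebraicIndependent.map' (f := (Complex.ofRealAm).restrictScalars ℚ) hp
    Complex.ofReal_injective

/-- In a frame at `P` and `Q`, the distance between two points is determined by their distances
to `P` and `Q` together with the product of their signed areas. -/
theorem sqLen_sub_eq_iff_signedArea_mul_eq {K : Type*} [Field K] [CharZero K]
    {P Q A B P' Q' A' B' : Fin 2 → K} (hPQ : sqLen (P - Q) ≠ 0)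
    (h : sqLen (P - Q) = sqLen (P' - Q')) (hAP : sqLen (A - P) = sqLen (A' - P'))
    (hAQ : sqLen (A - Q) = sqLen (A' - Q')) (hBP : sqLen (B - P) = sqLen (B' - P'))
    (hBQ : sqLen (B - Q) = sqLen (B' - Q')) :
    sqLen (A - B) = sqLen (A' - B') ↔
      signedArea P Q A * signedArea P Q B = signedArea P' Q' A' * signedArea P' Q' B' := by
  have e := four_mul_signedArea_mul_signedArea P Q A B
  have e' := four_mul_signedArea_mul_signedArea P' Q' A' B'
  rw [← h, ← hAP, ← hAQ, ← hBP, ← hBQ] at e'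
  constructor
  · intro hAB
    rw [← hAB, ← e] at e'
    exact (mul_left_cancel₀ (by norm_num) e').symm
  · intro hS
    rw [← hS, e] at e'
    refine mul_left_cancel₀ (mul_ne_zero two_ne_zero hPQ) ?_
    linear_combination -e'

/-- The congruence class of a realisation equivalent to `p`. -/
def CongruenceClasses.mk {V : Type*} {G : SimpleGraph V} {p : V → Fin 2 → ℂ}
    (q : V → Fin 2 → ℂ) (hq : FrameworkEquivalent G p q) : CongruenceClasses G p :=
  Quotient.mk (congruenceSetoid G p) ⟨q, hq⟩

theorem CongruenceClasses.mk_eq_mk {V : Type*} {G : SimpleGraph V} {p : V → Fin 2 → ℂ}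
    {q q' : V → Fin 2 → ℂ} (hq : FrameworkEquivalent G p q) (hq' : FrameworkEquivalent G p q') :
    mk q hq = mk q' hq' ↔ FrameworkCongruent q q' :=
  Quotient.eq (r := congruenceSetoid G p)

theorem CongruenceClasses.exists_mk_eq {V : Type*} {G : SimpleGraph V} {p : V → Fin 2 → ℂ}
    (c : CongruenceClasses G p) : ∃ q, ∃ hq : FrameworkEquivalent G p q, mk q hq = c := by
  obtain ⟨⟨q, hq⟩, rfl⟩ := Quotient.exists_rep c
  exact ⟨q, hq, rfl⟩

/-- Restriction of congruence classes to an induced subgraph. -/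
def CongruenceClasses.restrict {V : Type*} {G : SimpleGraph V} {p : V → Fin 2 → ℂ} (s : Set V) :
    CongruenceClasses G p → CongruenceClasses (G.induce s) (fun v : s => p v) :=
  Quotient.lift (fun q => mk (fun v : s => q.1 v) fun u v huv => q.2 u v huv)
    fun _ _ h => (mk_eq_mk _ _).2 fun u v => h u v

theorem card_fiber_restrict_compl {V : Type*} {G : SimpleGraph V} (hG : G.IsAlgebraicallyRigid)
    {vn v₁ v₂ v₃ : V} (h₁₂ : v₁ ≠ v₂) (h₁₃ : v₁ ≠ v₃) (h₂₃ : v₂ ≠ v₃) (h₃ : v₃ ≠ vn)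
    (hN : G.neighborSet vn = {v₁, v₂})
    (hH : (G.induce ({vn}ᶜ : Set V)).IsAlgebraicallyRigid)
    {p : V → Fin 2 → ℂ} (hp : IsGeneric p)
    (c : CongruenceClasses (G.induce ({vn}ᶜ : Set V)) fun v => p v) :
    Nat.card {c' : CongruenceClasses G p // c'.restrict {vn}ᶜ = c} = 2 := by
  have hv₁ : v₁ ≠ vn := (G.ne_of_adj (show v₁ ∈ G.neighborSet vn by simp [hN])).symm
  have hv₂ : v₂ ≠ vn := (G.ne_of_adj (show v₂ ∈ G.neighborSet vn by simp [hN])).symm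
  let w₁ : ({vn}ᶜ : Set V) := ⟨v₁, hv₁⟩
  let w₂ : ({vn}ᶜ : Set V) := ⟨v₂, hv₂⟩
  let w₃ : ({vn}ᶜ : Set V) := ⟨v₃, h₃⟩
  obtain ⟨q, hq, rfl⟩ := c.exists_mk_eq
  have hpH : IsGeneric fun v : ({vn}ᶜ : Set V) => p v := hp.restrict _
  have hw₁₂ : w₁ ≠ w₂ := fun h => h₁₂ (congrArg Subtype.val h)
  have hD : sqLen (q w₁ - q w₂) ≠ 0 := hH.sqLen_ne_zero hpH hq hw₁₂
  have hS₃ : signedArea (q w₁) (q w₂) (q w₃) ≠ 0 := hH.signedArea_ne_zero hpH hq hw₁₂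
    (fun h => h₁₃ (congrArg Subtype.val h)) (fun h => h₂₃ (congrArg Subtype.val h))
  set a := sqLen (p vn - p v₁)
  set b := sqLen (p vn - p v₂)
  obtain ⟨β, hβ⟩ := IsAlgClosed.exists_pow_nat_eq
    (a / sqLen (q w₁ - q w₂) - circleCoord (q w₁) (q w₂) a b ^ 2) two_pos
  let x (γ : ℂ) : Fin 2 → ℂ := circlePoint (q w₁) (q w₂) a b γ
  let Q (γ : ℂ) : V → Fin 2 → ℂ := extendRealisation q (x γ)
  have e₁ : ∀ γ, Q γ v₁ = q w₁ := fun γ => extendRealisation_coe q _ w₁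
  have e₂ : ∀ γ, Q γ v₂ = q w₂ := fun γ => extendRealisation_coe q _ w₂
  have eH : ∀ γ (u : ({vn}ᶜ : Set V)), Q γ u = q u := fun γ => extendRealisation_coe q _
  have en : ∀ γ, Q γ vn = x γ := fun γ => extendRealisation_self q _
  have hxa : ∀ γ, γ ^ 2 = β ^ 2 → sqLen (x γ - q w₁) = a := fun γ hγ =>
    sqLen_circlePoint_sub_left hD (hγ.trans hβ)
  have hxb : ∀ γ, γ ^ 2 = β ^ 2 → sqLen (x γ - q w₂) = b := fun γ hγ =>
    sqLen_circlePoint_sub_right hD (hγ.trans hβ)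
  have hQ : ∀ γ, γ ^ 2 = β ^ 2 → FrameworkEquivalent G p (Q γ) := fun γ hγ => by
    rw [frameworkEquivalent_iff_induce_compl hN, e₁, e₂, en, hxa γ hγ, hxb γ hγ]
    exact ⟨by simpa [Q] using hq, rfl, rfl⟩
  have hxS : ∀ γ, signedArea (q w₁) (q w₂) (x γ) = γ * sqLen (q w₁ - q w₂) := fun γ =>
    signedArea_circlePoint
  -- `Q β` is itself equivalent to the generic `p`, so `vn` cannot fall on the line.
  have hβ0 : β ≠ 0 := by
    have := hG.signedArea_ne_zero hp (hQ β rfl) h₁₂ hv₁ hv₂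
    rw [e₁, e₂, en, hxS] at this
    exact left_ne_zero_of_mul this
  have hrestrict : ∀ γ hγ, (CongruenceClasses.mk (Q γ) (hQ γ hγ)).restrict {vn}ᶜ =
      CongruenceClasses.mk q hq := fun γ hγ => by
    refine (CongruenceClasses.mk_eq_mk _ _).2 fun u v => ?_
    simp [Q]
  rw [Nat.card_eq_two_iff]
  refine ⟨⟨_, hrestrict β rfl⟩, ⟨_, hrestrict (-β) (neg_sq β)⟩, ?_, ?_⟩
  · intro h
    rw [Subtype.mk.injEq, CongruenceClasses.mk_eq_mk] at h
    have h' := h vn w₃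
    rw [en, en, eH, eH,
      sqLen_sub_eq_iff_signedArea_mul_eq hD rfl ((hxa β rfl).trans (hxa _ (neg_sq β)).symm)
        ((hxb β rfl).trans (hxb _ (neg_sq β)).symm) rfl rfl, hxS, hxS] at h'
    have h'' := mul_right_cancel₀ hD (mul_right_cancel₀ hS₃ h')
    exact hβ0 (self_eq_neg.1 h'')
  · rw [Set.eq_univ_iff_forall]
    rintro ⟨c', hc'⟩
    obtain ⟨q', hq', rfl⟩ := c'.exists_mk_eq
    have hcong : FrameworkCongruent (fun v : ({vn}ᶜ : Set V) => q' v) q :=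
      (CongruenceClasses.mk_eq_mk _ _).1 hc'
    obtain ⟨-, hq'a, hq'b⟩ := (frameworkEquivalent_iff_induce_compl hN _ _).1 hq'
    have hD' : sqLen (q w₁ - q w₂) = sqLen (q' v₁ - q' v₂) := (hcong w₁ w₂).symm
    have hS' : ∀ u v : ({vn}ᶜ : Set V),
        signedArea (q w₁) (q w₂) (q u) * signedArea (q w₁) (q w₂) (q v) =
        signedArea (q' v₁) (q' v₂) (q' u) * signedArea (q' v₁) (q' v₂) (q' v) := fun u v =>
      (sqLen_sub_eq_iff_signedArea_mul_eq hD hD' (hcong u w₁).symm (hcong u w₂).symm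
        (hcong v w₁).symm (hcong v w₂).symm).1 (hcong u v).symm
    have hSn : signedArea (q w₁) (q w₂) (x β) * signedArea (q w₁) (q w₂) (x β) =
        signedArea (q' v₁) (q' v₂) (q' vn) * signedArea (q' v₁) (q' v₂) (q' vn) :=
      (sqLen_sub_eq_iff_signedArea_mul_eq hD hD' ((hxa β rfl).trans hq'a)
        ((hxb β rfl).trans hq'b) ((hxa β rfl).trans hq'a) ((hxb β rfl).trans hq'b)).1
        (by simp [sqLen])
    -- The congruence from `q` to the restriction of `q'` may reverse orientation (sign `ε`), and
    -- `vn` may have changed sign of area (`δ`); hence `γ = ε * δ * β`.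
    have key : ∃ γ, ∃ hγ : γ ^ 2 = β ^ 2, ∀ u : ({vn}ᶜ : Set V),
        signedArea (q w₁) (q w₂) (x γ) * signedArea (q w₁) (q w₂) (q u) =
        signedArea (q' v₁) (q' v₂) (q' vn) * signedArea (q' v₁) (q' v₂) (q' u) := by
      have unit : ∀ s t : ℂ, s * s = t * t → ∃ ε : ℂ, ε ^ 2 = 1 ∧ t = ε * s := fun s t h => by
        rcases mul_self_eq_mul_self_iff.1 h with h | h
        · exact ⟨1, by simp, by simp [h]⟩
        · exact ⟨-1, by simp, by simp [h]⟩
      obtain ⟨ε, hε, hε₃⟩ := unit _ _ (hS' w₃ w₃)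
      obtain ⟨δ, hδ, hδn⟩ := unit _ _ hSn
      have hu : ∀ u : ({vn}ᶜ : Set V),
          signedArea (q' v₁) (q' v₂) (q' u) = ε * signedArea (q w₁) (q w₂) (q u) := fun u => by
        have h := hS' u w₃
        rw [hε₃] at h
        refine mul_right_cancel₀ hS₃ ?_
        linear_combination (-signedArea (q' v₁) (q' v₂) (q' u) *
          signedArea (q w₁) (q w₂) (q w₃)) * hε - ε * h
      refine ⟨ε * δ * β, by rw [mul_pow, mul_pow, hε, hδ, one_mul, one_mul], fun u => ?_⟩
      rw [hδn, hu, hxS, hxS]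
      ring
    obtain ⟨γ, hγ, hγS⟩ := key
    have hQq' : FrameworkCongruent (Q γ) q' := by
      rw [frameworkCongruent_iff_compl (vn := vn)]
      refine ⟨fun u v => ?_, fun u => ?_⟩
      · simpa [Q] using (hcong u v).symm
      · rw [en, eH]
        exact (sqLen_sub_eq_iff_signedArea_mul_eq hD hD' ((hxa γ hγ).trans hq'a)
          ((hxb γ hγ).trans hq'b) (hcong u w₁).symm (hcong u w₂).symm).2 (hγS u)
    have := (CongruenceClasses.mk_eq_mk (hQ γ hγ) hq').2 hQq'
    simp only [Set.mem_insert_iff, Set.mem_singleton_iff, Subtype.mk.injEq, ← this]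
    rcases sq_eq_sq_iff_eq_or_eq_neg.1 hγ with rfl | rfl
    · exact .inl rfl
    · exact .inr rfl

theorem SimpleGraph.IsAlgebraicallyRigid.card_congruenceClasses {V : Type*} [Finite V]
    {G : SimpleGraph V} (hG : G.IsAlgebraicallyRigid)
    {vn v₁ v₂ v₃ : V} (h₁₂ : v₁ ≠ v₂) (h₁₃ : v₁ ≠ v₃) (h₂₃ : v₂ ≠ v₃) (h₃ : v₃ ≠ vn)
    (hN : G.neighborSet vn = {v₁, v₂})
    (hH : (G.induce ({vn}ᶜ : Set V)).IsAlgebraicallyRigid)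
    {p : V → Fin 2 → ℂ} (hp : IsGeneric p) :
    Nat.card (CongruenceClasses G p) =
      2 * Nat.card (CongruenceClasses (G.induce ({vn}ᶜ : Set V)) fun v => p v) := by
  have := hG.finite_congruenceClasses hp
  have := hH.finite_congruenceClasses (hp.restrict _)
  have := Fintype.ofFinite (CongruenceClasses (G.induce ({vn}ᶜ : Set V)) fun v => p v)
  rw [Nat.card_congr (Equiv.sigmaFiberEquiv
    (CongruenceClasses.restrict (G := G) (p := p) ({vn}ᶜ : Set V))).symm, Nat.card_sigma]
  simp only [card_fiber_restrict_compl hG h₁₂ h₁₃ h₂₃ h₃ hN hH hp]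
  simp [Nat.card_eq_fintype_card, mul_comm]

theorem mainTheorem7 {V : Type*} [Fintype V] (G : SimpleGraph V) (hG : IsRigidGraph G)
    (hcard : 4 ≤ Fintype.card V) (vn v₁ v₂ : V) (h₁₂ : v₁ ≠ v₂)
    (hN : G.neighborSet vn = {v₁, v₂}) :
    IsRigidGraph (G.induce ({vn}ᶜ : Set V)) ∧
    IsRealisationNumber G (realisationNumber G) ∧
    IsRealisationNumber (G.induce ({vn}ᶜ : Set V))
      (realisationNumber (G.induce ({vn}ᶜ : Set V))) ∧
    realisationNumber G = 2 * realisationNumber (G.induce ({vn}ᶜ : Set V)) := by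
  classical
  obtain ⟨p, hp, hpG⟩ := hG
  have hpH := hpG.induce_compl h₁₂ hN hp
  have hGa := hpG.isAlgebraicallyRigid hp
  have hHa := hpH.isAlgebraicallyRigid (hp.restrict _)
  have hP := hp.ofReal
  have hPH := hP.restrict ({vn}ᶜ : Set V)
  have hkG := (hGa.isRealisationNumber hP).realisationNumber
  have hkH := (hHa.isRealisationNumber hPH).realisationNumber
  refine ⟨⟨_, hp.restrict _, hpH⟩, hkG, hkH, ?_⟩
  -- Four vertices are needed here: with no third vertex in `H`, the two mirror placements would be
  -- congruent.
  obtain ⟨v₃, hv₃⟩ : ∃ v₃, v₃ ∉ ({vn, v₁, v₂} : Finset V) := by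
    by_contra! h
    have := Finset.card_le_card (fun v _ => h v : Finset.univ ⊆ ({vn, v₁, v₂} : Finset V))
    have := Finset.card_le_three (a := vn) (b := v₁) (c := v₂)
    rw [Finset.card_univ] at *
    omega
  simp only [Finset.mem_insert, Finset.mem_singleton, not_or] at hv₃
  rw [← (hkG _ hP).2, ← (hkH _ hPH).2]
  exact hGa.card_congruenceClasses h₁₂ (Ne.symm hv₃.2.1) (Ne.symm hv₃.2.2) hv₃.1 hN hHa hP
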